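/- For a submonoid $S$ of $(\mathbb{N},+)$ let $\mathrm{Irr}(S)$ be the set of positive elements of $S$ that are not the sum of two positive elements of $S$, and let $S/d=\{x\in\mathbb{N} : dx\in S\}$ for a positive integer $d$. Let $\langle A\rangle$ denote the submonoid generated by $A$; a set $A\subset\mathbb{N}$ is $\mathbb{N}$-independent if $x\notin\langle A\setminus\{x\}\rangle$ for all $x\in A$. For integers $x_1,\dots,x_k\geq 2$ put $\lceil x_1\rceil=x_1$ and $\lceil x_1,\dots,x_k\rceil=x_1-1/\lceil x_2,\dots,x_k\rceil$ for $k\ge 2$. Let $I$ be a finite $\mathbb{N}$-independent subset of $\mathbb{N}\setminus\{0,1\}$. An admissible enumeration of $I$ is a sequence $(n_k)_{0\le k\le r}$ with $r\ge1$ that enumerates $I$ without repetition, such that $\gcd(n_0,n_1)=1$ and such that for every $1\le i\le r-1$ there is an integer $d_i\geq 2$ with $n_{i+1}=d_in_i-n_{i-1}$. Suppose that $I$ has an admissible enumeration $(n_k)_{0\le k\le r}$, with coefficients $(d_i)_{1\le i\le r-1}$. (i) Let $\rho>r$ be an integer and let $d_r,\dots,d_{\rho-1}$ be integers bigger than $1$.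 Let $d,m$ be the coprime positive integers with $\frac dm=\lceil d_1,\dots,d_{\rho-1}\rceil$, let $q_r$ be the numerator of the reduced fraction of $\lceil d_1,\dots,d_r\rceil$, and put $a=n_0$, $b=dn_1-mn_0$. If $\gcd(a,b)=1$, $a\leq q_r$ and $d<b$, then $a,b,d$ are pairwise coprime, $a<d<b$ and $\mathrm{Irr}\left(\frac{\langle a,b\rangle}{d}\right)=I$. (ii) Every triple $(a,b,d)$ of pairwise coprime positive integers with $a<d<b$ and $\mathrm{Irr}\left(\frac{\langle a,b\rangle}{d}\right)=I$ is obtained as in (i), with the three conditions there satisfied, from some admissible enumeration of $I$ (not necessarily the given one). (iii) For the given enumeration, infinitely many triples $(a,b,d)$ of pairwise coprime positive integers with $a<d<b$ and $\mathrm{Irr}\left(\frac{\langle a,b\rangle}{d}\right)=I$ are obtained as in (i) with $\rho=r+1$ (and its three conditions satisfied). -/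

import Mathlib

namespace ReverseProblem

/-- The numerical semigroup `⟨a, b⟩` of all non-negative integer combinations of `a` and `b`. -/
def span2 (a b : ℕ) : AddSubmonoid ℕ :=
  AddSubmonoid.closure {a, b}

/-- The quotient `S / d = {x ∈ ℕ | d x ∈ S}`. -/
def quot (S : AddSubmonoid ℕ) (d : ℕ) : AddSubmonoid ℕ where
  carrier := {x | d * x ∈ S}
  zero_mem' := by simp
  add_mem' := by
    intro x y hx hy
    simpa [mul_add] using S.add_mem hx hy

/-- The set `Irr(S)` of irreducible elements of a submonoid `S` of `ℕ`: the positive elements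
of `S` that are not the sum of two positive elements of `S`. -/
def Irr (S : AddSubmonoid ℕ) : Set ℕ :=
  {s | s ∈ S ∧ 0 < s ∧ ¬ ∃ x ∈ S, ∃ y ∈ S, 0 < x ∧ 0 < y ∧ s = x + y}

/-- A subset `A` of `ℕ` is `ℕ`-independent if no element of `A` belongs to the submonoid
generated by the other ones. -/
def NIndependent (A : Set ℕ) : Prop :=
  ∀ a ∈ A, a ∉ AddSubmonoid.closure (A \ {a})

/-- A sequence `(u_i)`, `0 ≤ i ≤ r`, is modular-convex if there are `c_i ∈ ℕ` such that
`u_{i-1} + u_{i+1} - 2 u_i = c_i u_i` for `0 < i < r`. Values of `u` beyond `r` play no role. -/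
def ModularConvex {M : Type*} [AddCommGroup M] (r : ℕ) (u : ℕ → M) : Prop :=
  ∃ c : ℕ → ℕ, ∀ i, 1 ≤ i → i < r → u (i - 1) + u (i + 1) - 2 • u i = c i • u i

/-- `n_0, …, n_r` (with `r ≥ 1`) is a modular-convex enumeration of `I`, without repetition,
with `n_0` and `n_1` coprime. Values of `n` beyond `r` play no role. -/
structure IsModularEnum (I : Finset ℕ) (r : ℕ) (n : ℕ → ℕ) : Prop where
  one_le : 1 ≤ r
  bijOn : Set.BijOn n (Set.Icc 0 r) (I : Set ℕ)
  modularConvex : ModularConvex r (fun i => (n i : ℤ))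
  coprime : Nat.Coprime (n 0) (n 1)

/-- The ceiling continued fraction `⌈d_0, d_1, …, d_k⌉ = d_0 - 1 / ⌈d_1, …, d_k⌉`
(the value at the empty list is a dummy). -/
def ceilCF : List ℤ → ℚ
  | [] => 0
  | [x] => x
  | x :: y :: l => x - 1 / ceilCF (y :: l)

/-- The ceiling convergent `⌈δ_1, …, δ_i⌉`. -/
def ceilConv (δ : ℕ → ℤ) (i : ℕ) : ℚ :=
  ceilCF ((List.range' 1 i).map δ)

/-- `δ_1, …, δ_{ρ-1}` are integers bigger than `1` that extend, beyond the index `r - 1`, the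
coefficients `δ_1, …, δ_{r-1}` of `n_0, …, n_r` given by `n_{i+1} = δ_i n_i - n_{i-1}`. -/
structure IsExtension (r : ℕ) (n : ℕ → ℕ) (ρ : ℕ) (δ : ℕ → ℤ) : Prop where
  lt : r < ρ
  two_le : ∀ i, 1 ≤ i → i < ρ → 2 ≤ δ i
  recur : ∀ i, 1 ≤ i → i < r → (n (i + 1) : ℤ) = δ i * n i - n (i - 1)

/-- `a = n_0` and `b = d n_1 - m n_0`, where `d` and `m` are the coprime positive integers
with `d / m = ⌈δ_1, …, δ_{ρ-1}⌉`. -/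
def IsTriple (n : ℕ → ℕ) (ρ : ℕ) (δ : ℕ → ℤ) (a b d : ℕ) : Prop :=
  ∃ m : ℕ, 0 < d ∧ 0 < m ∧ Nat.Coprime d m ∧ (d : ℚ) / m = ceilConv δ (ρ - 1) ∧
    a = n 0 ∧ (b : ℤ) = d * n 1 - m * n 0

/-- The conditions `gcd(a, b) = 1`, `a ≤ q_r` and `d < b`, where `q_r` is the numerator of the
reduced fraction of `⌈δ_1, …, δ_r⌉`. -/
def Admissible (r : ℕ) (δ : ℕ → ℤ) (a b d : ℕ) : Prop :=
  Nat.Coprime a b ∧ (a : ℤ) ≤ (ceilConv δ r).num ∧ d < b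

/-- `a`, `b`, `d` are pairwise coprime, `a < d < b` and `Irr(⟨a, b⟩ / d) = I`. -/
def IsSolution (I : Finset ℕ) (a b d : ℕ) : Prop :=
  Nat.Coprime a b ∧ Nat.Coprime a d ∧ Nat.Coprime b d ∧ a < d ∧ d < b ∧
    Irr (quot (span2 a b) d) = (I : Set ℕ)

end ReverseProblem

/-! With m defined by b ≡ -m a mod d, the quotient `⟨a, b⟩ / d` is the image, under the form (u a +
v b) / d, of the points (u, v) of ℕ² with u ≡ m v mod d. The Hilbert basis (U_i, V_i) of this cone
runs from (d, 0) to (0, d) and is read off the expansion d / m = ⌈δ_1, …, δ_{ρ-1}⌉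
(Hirzebruch–Jung): V_i is `convNum δ i` and U_i is `coneFst ρ δ i`. The basis obeys the recurrence
with coefficients δ_i, hence so do its values, which begin with a and n_1.

Adding multiples of (b, -a) does not change the value, so v < a may be assumed. Hence the values of
index at most r generate as soon as a ≤ V_{r+1} = q_r (`quot_eq_closure`, through `coneFst_le`). If
V_i < a, then U_i ≤ d < b makes the representation of the i-th value unique, and that value is
irreducible (`coneVal_mem_Irr`).

Part (i) combines generation with independence. Part (ii) expands d / m and cuts where V_r < a ≤
V_{r+1}. In (iii) only δ_r = t is free and b = t n_r - n_{r-1}. Dirichlet's theorem makes b a large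
prime, and d < b for large t because V_r < n_r (`IsModularEnum.convNum_lt`). -/

namespace ReverseProblem

/-! ### Convergents of ceiling continued fractions -/

/-- The numerators of the ceiling convergents: `convNum δ (i + 1)` is the numerator of
`⌈δ_1, …, δ_i⌉`. -/
def convNum (δ : ℕ → ℤ) : ℕ → ℤ
  | 0 => 0
  | 1 => 1
  | k + 2 => δ (k + 1) * convNum δ (k + 1) - convNum δ k

/-- The denominators of the ceiling convergents: `convDen δ (i + 1)` is the denominator of
`⌈δ_1, …, δ_i⌉`. -/
def convDen (δ : ℕ → ℤ) : ℕ → ℤ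
  | 0 => -1
  | 1 => 0
  | k + 2 => δ (k + 1) * convDen δ (k + 1) - convDen δ k

lemma convNum_rec (δ : ℕ → ℤ) (k : ℕ) :
    convNum δ (k + 2) = δ (k + 1) * convNum δ (k + 1) - convNum δ k := rfl

lemma convDen_rec (δ : ℕ → ℤ) (k : ℕ) :
    convDen δ (k + 2) = δ (k + 1) * convDen δ (k + 1) - convDen δ k := rfl

/-- The recursion preserves this determinant. The formal convergent 0 / (-1) at index 0 starts it at
1 and later yields the axis point (d, 0). -/
lemma convNum_mul_convDen_sub (δ : ℕ → ℤ) (i : ℕ) :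
    convNum δ i * convDen δ (i + 1) - convNum δ (i + 1) * convDen δ i = 1 := by
  induction i with
  | zero => simp [convNum, convDen]
  | succ k ih => rw [convNum_rec, convDen_rec]; linarith

lemma isCoprime_convNum_convDen (δ : ℕ → ℤ) (i : ℕ) :
    IsCoprime (convNum δ i) (convDen δ i) :=
  ⟨convDen δ (i + 1), -convNum δ (i + 1), by linarith [convNum_mul_convDen_sub δ i]⟩

lemma convDen_succ_eq_convNum_shift (δ : ℕ → ℤ) (i : ℕ) :
    convDen δ (i + 1) = convNum (fun k => δ (k + 1)) i := by
  induction i using Nat.twoStepInduction with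
  | zero => rfl
  | one => simp [convDen, convNum]
  | more k h1 h2 => rw [convDen_rec, h1, h2, convNum_rec]

lemma convNum_succ_eq_shift (δ : ℕ → ℤ) (i : ℕ) :
    convNum δ (i + 1) =
      δ 1 * convNum (fun k => δ (k + 1)) i - convDen (fun k => δ (k + 1)) i := by
  induction i using Nat.twoStepInduction with
  | zero => simp [convDen, convNum]
  | one => simp [convDen, convNum]
  | more k h1 h2 => rw [convNum_rec, h1, h2, convNum_rec, convDen_rec]; ring

lemma convNum_nonneg_lt {δ : ℕ → ℤ} {i : ℕ} (h : ∀ j, 1 ≤ j → j ≤ i → 2 ≤ δ j) :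
    0 ≤ convNum δ i ∧ convNum δ i < convNum δ (i + 1) := by
  induction i with
  | zero => simp [convNum]
  | succ k ih =>
    obtain ⟨h0, h1⟩ := ih fun j hj hjk => h j hj (by omega)
    have h2 := h (k + 1) (by omega) le_rfl
    refine ⟨by omega, ?_⟩
    rw [convNum_rec]
    nlinarith

lemma convDen_pos {δ : ℕ → ℤ} {i : ℕ} (hi : 1 ≤ i) (h : ∀ j, 1 ≤ j → j ≤ i → 2 ≤ δ j) :
    0 < convDen δ (i + 1) := by
  rw [convDen_succ_eq_convNum_shift]
  obtain ⟨k, rfl⟩ : ∃ k, i = k + 1 := ⟨i - 1, by omega⟩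
  have := convNum_nonneg_lt (δ := fun k => δ (k + 1)) (i := k)
    fun j hj hjk => h (j + 1) (by omega) (by omega)
  omega

lemma ceilConv_succ (δ : ℕ → ℤ) {i : ℕ} (hi : 1 ≤ i) :
    ceilConv δ (i + 1) = δ 1 - 1 / ceilConv (fun k => δ (k + 1)) i := by
  obtain ⟨k, rfl⟩ : ∃ k, i = k + 1 := ⟨i - 1, by omega⟩
  have h : (List.range' 2 (k + 1)).map δ = (List.range' 1 (k + 1)).map fun k => δ (k + 1) := by
    rw [List.range'_eq_map_range, List.range'_eq_map_range, List.map_map, List.map_map]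
    refine List.map_congr_left fun j _ => ?_
    simp only [Function.comp]
    congr 1
    omega
  unfold ceilConv
  rw [← h]
  simp only [List.range'_succ, List.map_cons, ceilCF]

lemma ceilConv_eq_div {i : ℕ} (hi : 1 ≤ i) :
    ∀ {δ : ℕ → ℤ}, (∀ j, 1 ≤ j → j ≤ i → 2 ≤ δ j) →
      ceilConv δ i = (convNum δ (i + 1) : ℚ) / convDen δ (i + 1) := by
  induction i, hi using Nat.le_induction with
  | base => intro δ _; simp [ceilConv, ceilCF, convNum, convDen]
  | succ i hi ih =>
    intro δ h
    have hs : ∀ j, 1 ≤ j → j ≤ i → 2 ≤ (fun k => δ (k + 1)) j :=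
      fun j hj hji => h (j + 1) (by omega) (by omega)
    have hpos : 0 < convNum (fun k => δ (k + 1)) (i + 1) := by
      have := convNum_nonneg_lt hs
      omega
    have hpos' : (convNum (fun k => δ (k + 1)) (i + 1) : ℚ) ≠ 0 := by exact_mod_cast hpos.ne'
    rw [ceilConv_succ δ hi, ih hs, convNum_succ_eq_shift δ (i + 1),
      convDen_succ_eq_convNum_shift δ (i + 1)]
    push_cast
    rw [one_div_div]
    field_simp

lemma num_ceilConv {δ : ℕ → ℤ} {i : ℕ} (hi : 1 ≤ i) (h : ∀ j, 1 ≤ j → j ≤ i → 2 ≤ δ j) :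
    (ceilConv δ i).num = convNum δ (i + 1) := by
  rw [ceilConv_eq_div hi h]
  exact Rat.num_div_eq_of_coprime (convDen_pos hi h)
    (Int.isCoprime_iff_nat_coprime.mp (isCoprime_convNum_convDen δ (i + 1)))

lemma den_ceilConv {δ : ℕ → ℤ} {i : ℕ} (hi : 1 ≤ i) (h : ∀ j, 1 ≤ j → j ≤ i → 2 ≤ δ j) :
    ((ceilConv δ i).den : ℤ) = convDen δ (i + 1) := by
  rw [ceilConv_eq_div hi h]
  exact Rat.den_div_eq_of_coprime (convDen_pos hi h)
    (Int.isCoprime_iff_nat_coprime.mp (isCoprime_convNum_convDen δ (i + 1)))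

/-- Every reduced fraction `d / m > 1` has a ceiling continued fraction expansion. -/
lemma exists_convNum_convDen_eq (m : ℕ) : ∀ d : ℕ, 0 < m → m < d → Nat.Coprime d m →
    ∃ (ρ : ℕ) (δ : ℕ → ℤ), 2 ≤ ρ ∧ (∀ i, 1 ≤ i → i < ρ → 2 ≤ δ i) ∧
      convNum δ ρ = d ∧ convDen δ ρ = m := by
  induction m using Nat.strong_induction_on with
  | _ m ih =>
    intro d hm hmd hco
    rcases Nat.lt_or_ge 1 m with h1 | h1
    · have hmod : 0 < d % m := by
        rcases Nat.eq_zero_or_pos (d % m) with h | h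
        · have := Nat.Coprime.eq_one_of_dvd hco.symm (Nat.dvd_of_mod_eq_zero h)
          omega
        · exact h
      have hlt := Nat.mod_lt d hm
      have hd := Nat.div_add_mod d m
      have hq : 1 ≤ d / m := Nat.div_pos hmd.le hm
      have hco' : Nat.Coprime m (m - d % m) := by
        rw [Nat.coprime_self_sub_right hlt.le, Nat.coprime_comm, Nat.Coprime, ← Nat.gcd_rec,
          Nat.gcd_comm]
        exact hco
      -- Division rounded up: d = (⌊d/m⌋ + 1) m - (m - d % m), so the tail is the expansion of m /
      -- (m - d % m).
      obtain ⟨ρ, ε, hρ, hε, hn, hdn⟩ := ih (m - d % m) (by omega) m (by omega) (by omega) hco'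
      refine ⟨ρ + 1, fun k => if k = 1 then (d / m : ℕ) + 1 else ε (k - 1), by omega, ?_, ?_⟩
      · intro i hi hiρ
        dsimp only
        split_ifs with h
        · omega
        · exact hε _ (by omega) (by omega)
      -- The shifted coefficients agree with `ε` except at index 0, which the recursions never read.
      · have hs : ∀ {δ δ' : ℕ → ℤ} (_ : ∀ k, 1 ≤ k → δ k = δ' k) (k : ℕ),
            convNum δ k = convNum δ' k ∧ convDen δ k = convDen δ' k := by
          intro δ δ' hδ k
          induction k using Nat.twoStepInduction with
          | zero => exact ⟨rfl, rfl⟩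
          | one => exact ⟨rfl, rfl⟩
          | more k h1 h2 =>
            rw [convNum_rec, convNum_rec, convDen_rec, convDen_rec, h1.1, h1.2, h2.1, h2.2,
              hδ _ (by omega)]
            exact ⟨rfl, rfl⟩
        have hs' := hs (δ := fun k => if k + 1 = 1 then ((d / m : ℕ) : ℤ) + 1 else ε (k + 1 - 1))
          (δ' := ε) (fun k hk => by simp [show k ≠ 0 by omega]) ρ
        rw [convNum_succ_eq_shift, convDen_succ_eq_convNum_shift, hs'.1, hs'.2, hn, hdn]
        refine ⟨?_, rfl⟩
        rw [Nat.cast_sub hlt.le]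
        simp only [if_true]
        have : (d : ℤ) = m * (d / m : ℕ) + (d % m : ℕ) := by exact_mod_cast hd.symm
        linarith
    · obtain rfl : m = 1 := by omega
      exact ⟨2, fun _ => d, le_rfl, fun i _ _ => by simp; omega, by simp [convNum],
        by simp [convDen]⟩

/-! ### Irreducible elements and generators -/

lemma mem_span2 {a b x : ℕ} : x ∈ span2 a b ↔ ∃ u v : ℕ, u * a + v * b = x := by
  simp [span2, AddSubmonoid.mem_closure_pair]

lemma mem_quot {S : AddSubmonoid ℕ} {d x : ℕ} : x ∈ quot S d ↔ d * x ∈ S := Iff.rfl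

lemma Irr_closure_subset (T : Set ℕ) : Irr (AddSubmonoid.closure T) ⊆ T := by
  rintro s ⟨hs, hpos, hirr⟩
  by_contra hsT
  have key : ∀ x ∈ AddSubmonoid.closure T, x = s → x ∈ T ∨ x = 0 := by
    intro x hx
    induction hx using AddSubmonoid.closure_induction with
    | mem x hx => exact fun _ => Or.inl hx
    | zero => exact fun _ => Or.inr rfl
    | add x y hx hy ihx ihy =>
      intro hxy
      rcases Nat.eq_zero_or_pos x with rfl | hx0
      · simpa using ihy (by simpa using hxy)
      rcases Nat.eq_zero_or_pos y with rfl | hy0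
      · simpa using ihx (by simpa using hxy)
      exact absurd ⟨x, hx, y, hy, hx0, hy0, hxy.symm⟩ hirr
  rcases key s hs rfl with h | h
  · exact hsT h
  · omega

lemma mem_closure_diff_of_lt {T : Set ℕ} {x y : ℕ} (hy : y ∈ AddSubmonoid.closure T)
    (hyx : y < x) : y ∈ AddSubmonoid.closure (T \ {x}) := by
  induction hy using AddSubmonoid.closure_induction with
  | mem y hy => exact AddSubmonoid.subset_closure ⟨hy, by simp; omega⟩
  | zero => exact zero_mem _
  | add y z _ _ ihy ihz => exact add_mem (ihy (by omega)) (ihz (by omega))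

/-- An `ℕ`-independent set consists of the irreducible elements of the monoid it generates. -/
lemma NIndependent.Irr_closure {T : Set ℕ} (hT : NIndependent T) (h0 : ∀ x ∈ T, x ≠ 0) :
    Irr (AddSubmonoid.closure T) = T := by
  refine (Irr_closure_subset T).antisymm fun x hx => ?_
  refine ⟨AddSubmonoid.subset_closure hx, Nat.pos_of_ne_zero (h0 x hx), ?_⟩
  rintro ⟨y, hy, z, hz, hy0, hz0, hxyz⟩
  refine hT x hx ?_
  have := add_mem (mem_closure_diff_of_lt (x := x) hy (by omega))
    (mem_closure_diff_of_lt (x := x) hz (by omega))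
  rwa [← hxyz] at this

/-! ### The cone spanned by the two axes -/

/-- The data attached to `⟨a, b⟩ / d`: the coprime integers `d` and `m` with
`d / m = ⌈δ_1, …, δ_{ρ-1}⌉` satisfy `b = d n_1 - m a`. -/
structure ConeData (ρ : ℕ) (δ : ℕ → ℤ) (a b d : ℕ) (n₁ : ℤ) : Prop where
  two_le : ∀ i, 1 ≤ i → i < ρ → 2 ≤ δ i
  num_eq : convNum δ ρ = d
  eq_sub : (b : ℤ) = d * n₁ - convDen δ ρ * a
  coprime_ab : Nat.Coprime a b
  coprime_ad : Nat.Coprime a d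
  a_pos : 0 < a
  lt_b : d < b

/-- First coordinates of the Hilbert basis of the cone; the second ones are `convNum δ i`. -/
def coneFst (ρ : ℕ) (δ : ℕ → ℤ) (i : ℕ) : ℤ :=
  convDen δ ρ * convNum δ i - convNum δ ρ * convDen δ i

/-- The values of the linear form at the Hilbert basis of the cone. -/
def coneVal (δ : ℕ → ℤ) (a : ℕ) (n₁ : ℤ) (i : ℕ) : ℤ :=
  convNum δ i * n₁ - convDen δ i * a

lemma coneVal_rec (δ : ℕ → ℤ) (a : ℕ) (n₁ : ℤ) (k : ℕ) :
    coneVal δ a n₁ (k + 2) = δ (k + 1) * coneVal δ a n₁ (k + 1) - coneVal δ a n₁ k := by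
  simp only [coneVal, convNum_rec, convDen_rec]; ring

lemma coneFst_self (ρ : ℕ) (δ : ℕ → ℤ) : coneFst ρ δ ρ = 0 := by simp only [coneFst]; ring

/-- Coefficients at least 2 make the sequence convex; the induction descends from U_ρ = 0 and
U_{ρ-1} = 1. -/
lemma coneFst_nonneg_lt {ρ : ℕ} {δ : ℕ → ℤ} (h : ∀ i, 1 ≤ i → i < ρ → 2 ≤ δ i) {i : ℕ}
    (hi : i < ρ) : 0 ≤ coneFst ρ δ (i + 1) ∧ coneFst ρ δ (i + 1) < coneFst ρ δ i := by
  obtain ⟨σ, rfl⟩ : ∃ σ, ρ = σ + 1 := ⟨ρ - 1, by omega⟩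
  refine Nat.decreasingInduction' (n := σ) (m := i)
    (P := fun i => 0 ≤ coneFst (σ + 1) δ (i + 1) ∧ coneFst (σ + 1) δ (i + 1) < coneFst (σ + 1) δ i)
    ?_ (by omega) ?_
  · rintro k hk - ⟨h0, h1⟩
    have h2 := h (k + 1) (by omega) (by omega)
    have h3 : coneFst (σ + 1) δ k =
        δ (k + 1) * coneFst (σ + 1) δ (k + 1) - coneFst (σ + 1) δ (k + 2) := by
      simp only [coneFst, convNum_rec, convDen_rec]; ring
    refine ⟨by omega, ?_⟩
    rw [h3]
    nlinarith
  · rw [coneFst_self]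
    have := convNum_mul_convDen_sub δ σ
    refine ⟨le_rfl, ?_⟩
    simp only [coneFst]
    linarith

lemma exists_convNum_le_lt (δ : ℕ → ℤ) (v : ℤ) (hv : 0 ≤ v) (r : ℕ) (hr : v < convNum δ (r + 1)) :
    ∃ i ≤ r, convNum δ i ≤ v ∧ v < convNum δ (i + 1) := by
  induction r with
  | zero => exact ⟨0, le_rfl, by simpa [convNum] using hv, hr⟩
  | succ r ih =>
    rcases lt_or_ge v (convNum δ (r + 1)) with h | h
    · obtain ⟨i, hi, h'⟩ := ih h
      exact ⟨i, by omega, h'⟩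
    · exact ⟨r + 1, le_rfl, h, hr⟩

/-- A nonzero lattice point of the cone whose second coordinate is less than `v_{i+1}` has first
coordinate at least `u_i`. -/
lemma coneFst_le {ρ : ℕ} {δ : ℕ → ℤ} (h : ∀ i, 1 ≤ i → i < ρ → 2 ≤ δ i) {i : ℕ} (hi : i < ρ)
    {u v : ℤ} (hu : 0 ≤ u) (hv : 0 ≤ v) (huv : 0 < u + v)
    (hdvd : convNum δ ρ ∣ convDen δ ρ * v - u)
    (hvi : v < convNum δ (i + 1)) : coneFst ρ δ i ≤ u := by
  obtain ⟨w, hw⟩ := hdvd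
  obtain ⟨hu0, hu1⟩ := coneFst_nonneg_lt h hi
  obtain ⟨hv0, hv1⟩ := convNum_nonneg_lt (δ := δ) (i := i) fun j hj hji => h j hj (by omega)
  have hdet := convNum_mul_convDen_sub δ i
  -- Cramer's rule: consecutive Hilbert points form a lattice basis, and α, β are the coordinates of
  -- (u, v) in it.
  obtain ⟨α, hα⟩ : ∃ α, α = v * convDen δ (i + 1) - w * convNum δ (i + 1) := ⟨_, rfl⟩
  obtain ⟨β, hβ⟩ : ∃ β, β = convNum δ i * w - convDen δ i * v := ⟨_, rfl⟩
  have hv' : v = α * convNum δ i + β * convNum δ (i + 1) := by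
    rw [hα, hβ]; linear_combination (-v) * hdet
  have hw' : w = α * convDen δ i + β * convDen δ (i + 1) := by
    rw [hα, hβ]; linear_combination (-w) * hdet
  have hu' : u = α * coneFst ρ δ i + β * coneFst ρ δ (i + 1) := by
    have : u = convDen δ ρ * v - convNum δ ρ * w := by linarith
    rw [this, hv', hw']; simp only [coneFst]; ring
  generalize coneFst ρ δ i = U at *
  generalize coneFst ρ δ (i + 1) = U' at *
  generalize convNum δ i = V at *
  generalize convNum δ (i + 1) = V' at *
  by_contra! hlt
  -- If β ≤ 0, nonnegativity of v forces α > -β, hence u ≥ U. If β > 0, the bound v < V' forces α <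
  -- 0, and nonnegativity of u gives β > -α, hence v ≥ V'.
  rcases le_or_gt β 0 with hb | hb
  · have ha : 0 < α := by
      by_contra! ha
      nlinarith [mul_nonneg (neg_nonneg.2 ha) hv0, mul_nonneg (neg_nonneg.2 hb) (hv0.trans hv1.le),
        mul_nonneg (neg_nonneg.2 ha) (hu0.trans hu1.le), mul_nonneg (neg_nonneg.2 hb) hu0]
    have h1 : -β < α := by
      by_contra! hab
      have hbn : 0 ≤ -β - α := by linarith
      have e1 : v = -(α * (V' - V)) - (-β - α) * V' := by rw [hv']; ring
      nlinarith [mul_pos ha (sub_pos.2 hv1), mul_nonneg hbn (hv0.trans hv1.le)]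
    have e2 : u = U + (α - 1 + β) * U + (-β) * (U - U') := by rw [hu']; ring
    nlinarith [mul_nonneg (show 0 ≤ α - 1 + β by omega) (hu0.trans hu1.le),
      mul_nonneg (neg_nonneg.2 hb) (sub_pos.2 hu1).le]
  · have ha : α < 0 := by
      by_contra! ha
      nlinarith [mul_nonneg ha hv0, mul_le_mul_of_nonneg_right (show 1 ≤ β by omega)
        (hv0.trans hv1.le)]
    have h1 : -α < β := by
      by_contra! hab
      have hbn : 0 ≤ -α - β := by linarith
      have e1 : u = -(β * (U - U')) - (-α - β) * U := by rw [hu']; ring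
      nlinarith [mul_pos hb (sub_pos.2 hu1), mul_nonneg hbn (hu0.trans hu1.le)]
    have e2 : v = V' + (β - 1 + α) * V' + (-α) * (V' - V) := by rw [hv']; ring
    nlinarith [mul_nonneg (show 0 ≤ β - 1 + α by omega) (hv0.trans hv1.le),
      mul_nonneg (neg_nonneg.2 ha.le) (sub_pos.2 hv1).le]

section
variable {ρ : ℕ} {δ : ℕ → ℤ} {a b d : ℕ} {n₁ : ℤ}

lemma convNum_nonneg (h : ∀ i, 1 ≤ i → i < ρ → 2 ≤ δ i) {i : ℕ} (hi : i ≤ ρ) :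
    0 ≤ convNum δ i := by
  rcases i with _ | i
  · simp [convNum]
  · have := convNum_nonneg_lt (δ := δ) (i := i) fun j hj hji => h j hj (by omega)
    omega

lemma convNum_strictMono (h : ∀ i, 1 ≤ i → i < ρ → 2 ≤ δ i) {i j : ℕ} (hij : i < j)
    (hj : j ≤ ρ) : convNum δ i < convNum δ j := by
  induction j, hij using Nat.le_induction with
  | base => exact (convNum_nonneg_lt (δ := δ) (i := i) fun k hk hki => h k hk (by omega)).2
  | succ j hij ih =>
    exact (ih (by omega)).trans
      (convNum_nonneg_lt (δ := δ) (i := j) fun k hk hki => h k hk (by omega)).2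

lemma coneFst_strictAnti (h : ∀ i, 1 ≤ i → i < ρ → 2 ≤ δ i) {i j : ℕ} (hij : i < j)
    (hj : j ≤ ρ) : coneFst ρ δ j < coneFst ρ δ i := by
  induction j, hij using Nat.le_induction with
  | base => exact (coneFst_nonneg_lt h (by omega)).2
  | succ j hij ih => exact (coneFst_nonneg_lt h (by omega)).2.trans (ih (by omega))

lemma coneFst_nonneg (h : ∀ i, 1 ≤ i → i < ρ → 2 ≤ δ i) {i : ℕ} (hi : i ≤ ρ) :
    0 ≤ coneFst ρ δ i := by
  rcases hi.lt_or_eq with hi | rfl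
  · have := coneFst_nonneg_lt h hi
    omega
  · rw [coneFst_self]

lemma coneFst_zero : coneFst ρ δ 0 = convNum δ ρ := by simp [coneFst, convNum, convDen]

lemma coneFst_le_convNum (h : ∀ i, 1 ≤ i → i < ρ → 2 ≤ δ i) {i : ℕ} (hi : i ≤ ρ) :
    coneFst ρ δ i ≤ convNum δ ρ := by
  rw [← coneFst_zero (δ := δ)]
  rcases Nat.eq_zero_or_pos i with rfl | h0
  · rfl
  · exact (coneFst_strictAnti h h0 hi).le

/-! ### Generators and irreducible elements of `⟨a, b⟩ / d` -/

namespace ConeData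

lemma mul_coneVal (h : ConeData ρ δ a b d n₁) (i : ℕ) :
    d * coneVal δ a n₁ i = coneFst ρ δ i * a + convNum δ i * b := by
  rw [h.eq_sub]
  simp only [coneVal, coneFst, h.num_eq]
  ring

lemma d_pos (h : ConeData ρ δ a b d n₁) (hρ : 1 ≤ ρ) : 0 < d := by
  have := convNum_strictMono h.two_le hρ le_rfl
  rw [h.num_eq] at this
  simpa [convNum] using this

lemma dvd_of_mul_eq (h : ConeData ρ δ a b d n₁) {u v x : ℤ} (hx : d * x = u * a + v * b) :
    convNum δ ρ ∣ convDen δ ρ * v - u := by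
  rw [h.num_eq]
  have h1 : (d : ℤ) ∣ (convDen δ ρ * v - u) * a := by
    refine ⟨v * n₁ - x, ?_⟩
    have := h.eq_sub
    linear_combination v * this + hx
  exact (Nat.isCoprime_iff_coprime.2 h.coprime_ad).symm.dvd_of_dvd_mul_right h1

lemma coneVal_pos (h : ConeData ρ δ a b d n₁) {i : ℕ} (hi : i ≤ ρ) (hρ : 1 ≤ ρ) :
    0 < coneVal δ a n₁ i := by
  have hd : (0 : ℤ) < d := by exact_mod_cast h.d_pos hρ
  have hb : (0 : ℤ) < b := by exact_mod_cast (h.d_pos hρ).trans h.lt_b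
  have ha : (0 : ℤ) < a := by exact_mod_cast h.a_pos
  refine pos_of_mul_pos_right ?_ hd.le
  rw [h.mul_coneVal]
  rcases hi.lt_or_eq with hi' | rfl
  · have := coneFst_strictAnti h.two_le hi' le_rfl
    rw [coneFst_self] at this
    have := convNum_nonneg h.two_le hi
    positivity
  · rw [coneFst_self]
    have := convNum_strictMono h.two_le (i := 0) hρ le_rfl
    simp only [convNum] at this
    positivity

lemma mem_quot_iff {x : ℕ} :
    x ∈ quot (span2 a b) d ↔ ∃ u v : ℤ, 0 ≤ u ∧ 0 ≤ v ∧ d * (x : ℤ) = u * a + v * b := by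
  rw [mem_quot, mem_span2]
  constructor
  · rintro ⟨u, v, h⟩
    exact ⟨u, v, by positivity, by positivity, by exact_mod_cast h.symm⟩
  · rintro ⟨u, v, hu, hv, h⟩
    lift u to ℕ using hu
    lift v to ℕ using hv
    exact ⟨u, v, by exact_mod_cast h.symm⟩

/-- Elements of `⟨a, b⟩ / d` have a representation whose second coordinate is less than `a`. -/
lemma exists_repr_lt (ha : 0 < a) {x : ℕ} (hx : x ∈ quot (span2 a b) d) :
    ∃ u v : ℤ, 0 ≤ u ∧ 0 ≤ v ∧ v < a ∧ d * (x : ℤ) = u * a + v * b := by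
  obtain ⟨u, v, hu, hv, h⟩ := mem_quot_iff.1 hx
  have ha' : (0 : ℤ) < a := by exact_mod_cast ha
  refine ⟨u + v / a * b, v % a, ?_, Int.emod_nonneg _ ha'.ne', Int.emod_lt_of_pos _ ha', ?_⟩
  · have := Int.ediv_nonneg hv ha'.le
    positivity
  · rw [h]
    linear_combination (-(b : ℤ)) * Int.emod_add_mul_ediv v a

lemma coneVal_mem (h : ConeData ρ δ a b d n₁) {i : ℕ} (hi : i ≤ ρ) {x : ℕ}
    (hx : (x : ℤ) = coneVal δ a n₁ i) : x ∈ quot (span2 a b) d := by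
  refine mem_quot_iff.2 ⟨_, _, coneFst_nonneg h.two_le hi, convNum_nonneg h.two_le hi, ?_⟩
  rw [hx, h.mul_coneVal]

/-- If `a ≤ v_{r+1}`, the values at the first `r + 1` points of the Hilbert basis generate. -/
lemma quot_eq_closure (h : ConeData ρ δ a b d n₁) {r : ℕ} (hr : r < ρ)
    (har : (a : ℤ) ≤ convNum δ (r + 1)) :
    quot (span2 a b) d =
      AddSubmonoid.closure {x : ℕ | ∃ i ≤ r, (x : ℤ) = coneVal δ a n₁ i} := by
  refine le_antisymm ?_ ?_
  · intro x
    induction x using Nat.strong_induction_on with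
    | _ x ih =>
      intro hx
      rcases Nat.eq_zero_or_pos x with rfl | hx0
      · exact zero_mem _
      obtain ⟨u, v, hu, hv, hva, hxuv⟩ := exists_repr_lt h.a_pos hx
      obtain ⟨i, hir, hiv, hvi⟩ := exists_convNum_le_lt δ v hv r (by omega)
      have hd : (0 : ℤ) < d := by exact_mod_cast h.d_pos (by omega)
      have huv : 0 < u + v := by
        by_contra! hle
        obtain rfl : u = 0 := by omega
        obtain rfl : v = 0 := by omega
        have : 0 < (d : ℤ) * x := by positivity
        simp at hxuv
        omega
      have hle := coneFst_le h.two_le (by omega) hu hv huv (h.dvd_of_mul_eq hxuv) hvi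
      have hpos := h.coneVal_pos (i := i) (by omega) (by omega)
      have hsub : d * ((x : ℤ) - coneVal δ a n₁ i) =
          (u - coneFst ρ δ i) * a + (v - convNum δ i) * b := by
        rw [mul_sub, hxuv, h.mul_coneVal]; ring
      have hnn : 0 ≤ (x : ℤ) - coneVal δ a n₁ i := by
        refine (mul_nonneg_iff_of_pos_left hd).1 ?_
        rw [hsub]
        have h1 := sub_nonneg.2 hle
        have h2 := sub_nonneg.2 hiv
        positivity
      obtain ⟨y, hy⟩ := Int.eq_ofNat_of_zero_le hnn
      obtain ⟨z, hz⟩ := Int.eq_ofNat_of_zero_le hpos.le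
      have hymem : y ∈ quot (span2 a b) d :=
        mem_quot_iff.2 ⟨_, _, sub_nonneg.2 hle, sub_nonneg.2 hiv, by rw [← hy]; exact hsub⟩
      obtain rfl : x = y + z := by omega
      exact add_mem (ih y (by omega) hymem) (AddSubmonoid.subset_closure ⟨i, hir, hz.symm⟩)
  · rw [AddSubmonoid.closure_le]
    rintro x ⟨i, hi, hx⟩
    exact h.coneVal_mem (by omega) hx

/-- As V_i < a and U_i ≤ d < b, the only representation of this value is (U_i, V_i). A decomposition
therefore lifts to one of the Hilbert point, which `coneFst_le` excludes. -/
lemma coneVal_mem_Irr (h : ConeData ρ δ a b d n₁) {i : ℕ} (hi : i < ρ)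
    (hia : convNum δ i < a) {x : ℕ} (hx : (x : ℤ) = coneVal δ a n₁ i) :
    x ∈ Irr (quot (span2 a b) d) := by
  have hpos := h.coneVal_pos hi.le (by omega)
  refine ⟨h.coneVal_mem hi.le hx, by omega, ?_⟩
  rintro ⟨y, hy, z, hz, hy0, hz0, hxyz⟩
  obtain ⟨u, v, hu, hv, hva, hyuv⟩ := exists_repr_lt h.a_pos hy
  obtain ⟨u', v', hu', hv', hva', hzuv⟩ := exists_repr_lt h.a_pos hz
  have hd : (0 : ℤ) < d := by exact_mod_cast h.d_pos (by omega)
  have hdb : (d : ℤ) < b := by exact_mod_cast h.lt_b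
  have ha : (0 : ℤ) < a := by exact_mod_cast h.a_pos
  have hUd := coneFst_le_convNum h.two_le hi.le
  rw [h.num_eq] at hUd
  have hsum : (u + u' - coneFst ρ δ i) * a = (convNum δ i - v - v') * b := by
    have h1 := h.mul_coneVal i
    rw [← hx, hxyz] at h1
    push_cast at h1
    linear_combination h1 - hyuv - hzuv
  have hdvd : (a : ℤ) ∣ convNum δ i - v - v' :=
    (Nat.isCoprime_iff_coprime.2 h.coprime_ab).dvd_of_dvd_mul_right ⟨_, by rw [← hsum, mul_comm]⟩
  -- The two representations differ by k (b, -a); V_i < a gives k < 1 and U_i < b gives k ≥ 0.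
  obtain ⟨k, hk⟩ := hdvd
  have hVi := convNum_nonneg h.two_le hi.le
  have hku : u + u' - coneFst ρ δ i = k * b := by
    refine mul_right_cancel₀ ha.ne' ?_
    rw [hsum, hk]; ring
  have hk1 : k < 1 := by
    by_contra! hk1
    nlinarith
  have hk0 : 0 ≤ k := by
    by_contra! hk0
    nlinarith
  obtain rfl : k = 0 := by omega
  have huv : 0 < u + v := by
    by_contra! hle
    obtain rfl : u = 0 := by omega
    obtain rfl : v = 0 := by omega
    have : 0 < (d : ℤ) * y := by positivity
    simp at hyuv
    omega
  obtain ⟨j, hji, hjv, hvj⟩ := exists_convNum_le_lt δ v hv i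
    (by have := convNum_strictMono h.two_le (i := i) (j := i + 1) (by omega) (by omega); linarith)
  have hle := coneFst_le h.two_le (by omega) hu hv huv (h.dvd_of_mul_eq hyuv) hvj
  rcases hji.lt_or_eq with hlt | rfl
  · have := coneFst_strictAnti h.two_le hlt hi.le
    linarith
  · obtain rfl : u' = 0 := by linarith
    obtain rfl : v' = 0 := by linarith
    have : 0 < (d : ℤ) * z := by positivity
    simp at hzuv
    omega

/-- Equal values give (U_i - U_j) a = (V_j - V_i) b, so a divides a difference smaller than a in
absolute value. -/
lemma coneVal_injOn (h : ConeData ρ δ a b d n₁) {i j : ℕ} (hi : i < ρ) (hj : j < ρ)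
    (hia : convNum δ i < a) (hja : convNum δ j < a)
    (hij : coneVal δ a n₁ i = coneVal δ a n₁ j) : i = j := by
  have h1 : (a : ℤ) ∣ convNum δ j - convNum δ i := by
    refine (Nat.isCoprime_iff_coprime.2 h.coprime_ab).dvd_of_dvd_mul_right
      ⟨coneFst ρ δ i - coneFst ρ δ j, ?_⟩
    have h1 := h.mul_coneVal i
    have h2 := h.mul_coneVal j
    rw [hij] at h1
    linear_combination h1 - h2
  have h0i := convNum_nonneg h.two_le hi.le
  have h0j := convNum_nonneg h.two_le hj.le
  have h2 := Int.eq_zero_of_abs_lt_dvd h1 (abs_lt.2 ⟨by omega, by omega⟩)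
  rcases lt_trichotomy i j with hlt | rfl | hlt
  · have := convNum_strictMono h.two_le hlt hj.le
    omega
  · rfl
  · have := convNum_strictMono h.two_le hlt hi.le
    omega

end ConeData

end

/-! ### Enumerations -/

lemma coneVal_eq_of_rec {r a : ℕ} {n : ℕ → ℕ} {δ : ℕ → ℤ} (h0 : a = n 0)
    (h : ∀ i, 1 ≤ i → i < r → (n (i + 1) : ℤ) = δ i * n i - n (i - 1)) {i : ℕ} (hi : i ≤ r) :
    coneVal δ a (n 1) i = n i := by
  induction i using Nat.twoStepInduction with
  | zero => simp [coneVal, convNum, convDen, h0]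
  | one => simp [coneVal, convNum, convDen]
  | more k h1 h2 =>
    rw [coneVal_rec, h1 (by omega), h2 (by omega), h (k + 1) (by omega) (by omega)]
    simp

lemma IsModularEnum.apply_mem {I : Finset ℕ} {r : ℕ} {n : ℕ → ℕ} (hn : IsModularEnum I r n)
    {i : ℕ} (hi : i ≤ r) : n i ∈ I := hn.bijOn.mapsTo ⟨Nat.zero_le _, hi⟩

lemma IsModularEnum.setOf_eq {I : Finset ℕ} {r : ℕ} {n : ℕ → ℕ} (hn : IsModularEnum I r n) :
    {x : ℕ | ∃ i ≤ r, x = n i} = (I : Set ℕ) := by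
  rw [← hn.bijOn.image_eq]
  ext x
  simp [eq_comm]

theorem isSolution_of_admissible {I : Finset ℕ} (hI : ∀ x ∈ I, x ≠ 0 ∧ x ≠ 1)
    (hind : NIndependent (I : Set ℕ)) {r : ℕ} {n : ℕ → ℕ} (hn : IsModularEnum I r n)
    {ρ : ℕ} {δ : ℕ → ℤ} {a b d : ℕ} (hext : IsExtension r n ρ δ) (ht : IsTriple n ρ δ a b d)
    (hadm : Admissible r δ a b d) : IsSolution I a b d := by
  obtain ⟨hrρ, h2, hrec⟩ := hext
  obtain ⟨m, hd, hm, hdm, hq, ha, hb⟩ := ht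
  obtain ⟨hab, haq, hdb⟩ := hadm
  have hr := hn.one_le
  obtain ⟨σ, rfl⟩ : ∃ σ, ρ = σ + 1 := ⟨ρ - 1, by omega⟩
  rw [Nat.add_sub_cancel] at hq
  have h2' : ∀ j, 1 ≤ j → j ≤ σ → 2 ≤ δ j := fun j hj hjσ => h2 j hj (by omega)
  rw [num_ceilConv hr fun j hj hjr => h2 j hj (by omega)] at haq
  have hm' : (0 : ℤ) < m := by exact_mod_cast hm
  have hnum : convNum δ (σ + 1) = d := by
    rw [← num_ceilConv (by omega) h2', ← hq]
    exact Rat.num_div_eq_of_coprime (a := d) (b := m) hm' (by simpa using hdm)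
  have hden : convDen δ (σ + 1) = m := by
    rw [← den_ceilConv (by omega) h2', ← hq]
    exact Rat.den_div_eq_of_coprime (a := d) (b := m) hm' (by simpa using hdm)
  have haI := hI _ (hn.apply_mem (Nat.zero_le r))
  rw [← ha] at haI
  -- A common divisor of a and d divides b = d n_1 - m a.
  have had : Nat.Coprime a d := by
    have h1 : IsCoprime (a : ℤ) b := Nat.isCoprime_iff_coprime.2 hab
    rw [hb, ← ha] at h1
    rw [← Nat.isCoprime_iff_coprime]
    rw [sub_eq_add_neg, ← neg_mul, IsCoprime.add_mul_right_right_iff] at h1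
    exact h1.of_mul_right_left
  have hbd : Nat.Coprime b d := by
    have h1 : IsCoprime (d : ℤ) (m * a) :=
      (Nat.isCoprime_iff_coprime.2 hdm).mul_right (Nat.isCoprime_iff_coprime.2 had).symm
    rw [← Nat.isCoprime_iff_coprime, hb, ← ha]
    refine IsCoprime.symm ?_
    rw [sub_eq_add_neg, add_comm, IsCoprime.add_mul_left_right_iff]
    exact h1.neg_right
  have hle : a ≤ d := by
    have : convNum δ (r + 1) ≤ convNum δ (σ + 1) := by
      rcases (show r + 1 ≤ σ + 1 from hrρ).lt_or_eq with h | h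
      · exact (convNum_strictMono h2 h le_rfl).le
      · rw [h]
    rw [hnum] at this
    exact_mod_cast haq.trans this
  have hlt : a < d := by
    refine lt_of_le_of_ne hle fun h => ?_
    rw [← h, Nat.coprime_self] at had
    exact haI.2 had
  have hcone : ConeData (σ + 1) δ a b d (n 1) :=
    ⟨h2, hnum, by rw [hden, hb, ha], hab, had, Nat.pos_of_ne_zero haI.1, hdb⟩
  refine ⟨hab, had, hbd, hlt, hdb, ?_⟩
  have hset : {x : ℕ | ∃ i ≤ r, (x : ℤ) = coneVal δ a (n 1) i} = (I : Set ℕ) := by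
    rw [← hn.setOf_eq]
    ext x
    refine exists_congr fun i => and_congr_right fun hi => ?_
    rw [coneVal_eq_of_rec ha hrec hi, Nat.cast_inj]
  rw [hcone.quot_eq_closure hrρ haq, hset]
  exact hind.Irr_closure fun x hx => (hI x hx).1

/-- The irreducible elements are exactly the values at Hilbert points with V_i < a, listed in the
order of the cone; this order is the enumeration. -/
theorem exists_admissible_of_isSolution {I : Finset ℕ} (hI : ∀ x ∈ I, x ≠ 0 ∧ x ≠ 1)
    {a b d : ℕ} (h : IsSolution I a b d) :
    ∃ (r : ℕ) (n : ℕ → ℕ) (ρ : ℕ) (δ : ℕ → ℤ), IsModularEnum I r n ∧ IsExtension r n ρ δ ∧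
      IsTriple n ρ δ a b d ∧ Admissible r δ a b d := by
  obtain ⟨hab, had, hbd, hlt, hdb, hIrr⟩ := h
  have ha0 : a ≠ 0 := by
    rintro rfl
    rw [Nat.coprime_zero_left] at hab
    omega
  have hd0 : 0 < d := by omega
  have ha1 : a ≠ 1 := by
    rintro rfl
    refine (hI 1 ?_).2 rfl
    rw [← Finset.mem_coe, ← hIrr]
    refine ⟨mem_quot.2 (mem_span2.2 ⟨d, 0, by ring⟩), one_pos, ?_⟩
    rintro ⟨x, -, y, -, hx, hy, hxy⟩
    omega
  -- the residue `m` with `m a ≡ -b` modulo `d`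
  obtain ⟨n₁, m, hm0, hmd, hb⟩ : ∃ n₁ : ℤ, ∃ m : ℕ, 0 < m ∧ m < d ∧ (b : ℤ) = d * n₁ - m * a := by
    obtain ⟨s, t, hst⟩ := Nat.isCoprime_iff_coprime.2 had
    have hdZ : (0 : ℤ) < d := by exact_mod_cast hd0
    obtain ⟨m, hm⟩ := Int.eq_ofNat_of_zero_le (Int.emod_nonneg (-(b * s)) hdZ.ne')
    have hmd := Int.emod_lt_of_pos (-(b * s)) hdZ
    have hdiv := Int.emod_add_mul_ediv (-(b * s) : ℤ) d
    rw [hm] at hmd hdiv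
    have hb : (b : ℤ) = d * (b * t - -(b * s) / d * a) - m * a := by
      linear_combination (-(b : ℤ)) * hst + (a : ℤ) * hdiv
    refine ⟨_, m, Nat.pos_of_ne_zero ?_, by exact_mod_cast hmd, hb⟩
    rintro rfl
    have : (d : ℤ) ∣ b := ⟨_, by rw [hb, Nat.cast_zero, zero_mul, sub_zero]⟩
    have := Nat.Coprime.eq_one_of_dvd hbd.symm (by exact_mod_cast this)
    omega
  have hdm : Nat.Coprime d m := by
    rw [← Nat.isCoprime_iff_coprime]
    have h1 : IsCoprime (d : ℤ) b := (Nat.isCoprime_iff_coprime.2 hbd).symm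
    rw [hb, sub_eq_add_neg, add_comm, IsCoprime.add_mul_left_right_iff, ← neg_mul] at h1
    exact (IsCoprime.neg_right_iff _ _).1 h1.of_mul_right_left
  obtain ⟨ρ, δ, hρ, h2, hnum, hden⟩ := exists_convNum_convDen_eq m d hm0 hmd hdm
  have hcone : ConeData ρ δ a b d n₁ :=
    ⟨h2, hnum, by rw [hden, hb], hab, had, Nat.pos_of_ne_zero ha0, hdb⟩
  obtain ⟨σ, rfl⟩ : ∃ σ, ρ = σ + 1 := ⟨ρ - 1, by omega⟩
  -- Bracketing a - 1 instead of a gives V_r < a ≤ V_{r+1}.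
  obtain ⟨r, hrσ, hra, har⟩ := exists_convNum_le_lt δ (a - 1) (by omega) σ (by omega)
  have hr1 : 1 ≤ r := by
    by_contra! hr
    obtain rfl : r = 0 := by omega
    simp only [convNum] at har
    omega
  have hVa : ∀ {i}, i ≤ r → convNum δ i < a := by
    intro i hi
    rcases hi.lt_or_eq with hi | rfl
    · have := convNum_strictMono h2 hi (by omega)
      omega
    · omega
  have hle_succ : (a : ℤ) ≤ convNum δ (r + 1) := by omega
  have hcast : ∀ {i}, i ≤ σ + 1 → ((coneVal δ a n₁ i).toNat : ℤ) = coneVal δ a n₁ i :=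
    fun {i} hi => Int.toNat_of_nonneg (hcone.coneVal_pos hi (by omega)).le
  have hn0 : coneVal δ a n₁ 0 = a := by simp [coneVal, convNum, convDen]
  have hn1 : coneVal δ a n₁ 1 = n₁ := by simp [coneVal, convNum, convDen]
  have hbij : Set.BijOn (fun i => (coneVal δ a n₁ i).toNat) (Set.Icc 0 r) (I : Set ℕ) := by
    rw [← hIrr]
    refine ⟨?_, ?_, ?_⟩
    · rintro i ⟨-, hi⟩
      exact hcone.coneVal_mem_Irr (by omega) (hVa hi) (hcast (by omega))
    · rintro i ⟨-, hi⟩ j ⟨-, hj⟩ hij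
      refine hcone.coneVal_injOn (by omega) (by omega) (hVa hi) (hVa hj) ?_
      rw [← hcast (i := i) (by omega), ← hcast (i := j) (by omega)]
      exact congrArg _ hij
    · intro x hx
      rw [hcone.quot_eq_closure (by omega) hle_succ] at hx
      obtain ⟨i, hi, hxi⟩ := Irr_closure_subset _ hx
      exact ⟨i, ⟨Nat.zero_le _, hi⟩, by dsimp only; omega⟩
  refine ⟨r, fun i => (coneVal δ a n₁ i).toNat, σ + 1, δ, ⟨hr1, hbij, ?_, ?_⟩,
    ⟨by omega, h2, ?_⟩, ⟨m, hd0, hm0, hdm, ?_, ?_, ?_⟩, hab, ?_, hdb⟩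
  -- Modular convexity is the recurrence with c_i = δ_i - 2.
  · refine ⟨fun i => (δ i - 2).toNat, fun i hi hir => ?_⟩
    obtain ⟨k, rfl⟩ : ∃ k, i = k + 1 := ⟨i - 1, by omega⟩
    have h2k := h2 (k + 1) (by omega) (by omega)
    simp only [Nat.add_sub_cancel]
    rw [hcast (by omega), hcast (by omega), hcast (by omega), coneVal_rec, nsmul_eq_mul,
      nsmul_eq_mul, Int.toNat_of_nonneg (by omega)]
    push_cast
    ring
  · rw [← Nat.isCoprime_iff_coprime, hcast (by omega), hcast (by omega), hn0, hn1]
    have h1 : IsCoprime (a : ℤ) b := Nat.isCoprime_iff_coprime.2 hab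
    rw [hb, sub_eq_add_neg, ← neg_mul, IsCoprime.add_mul_right_right_iff] at h1
    exact h1.of_mul_right_right
  · intro i hi hir
    obtain ⟨k, rfl⟩ : ∃ k, i = k + 1 := ⟨i - 1, by omega⟩
    rw [Nat.add_sub_cancel, hcast (by omega), hcast (by omega), hcast (by omega), coneVal_rec]
  · rw [Nat.add_sub_cancel, ceilConv_eq_div (by omega) fun j hj hjσ => h2 j hj (by omega), hnum,
      hden]
    simp
  · dsimp only
    rw [hn0, Int.toNat_natCast]
  · dsimp only
    rw [hcast (by omega), hcast (by omega), hn0, hn1, hb]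
  · rw [num_ceilConv hr1 fun j hj hjr => h2 j hj (by omega)]
    exact hle_succ

/-! ### Infinitely many triples from one enumeration -/

/-- In an admissible enumeration of an independent set, `n_i` exceeds the numerator of the
convergent of order `i - 1`. -/
lemma IsModularEnum.convNum_lt {I : Finset ℕ} (hI : ∀ x ∈ I, x ≠ 0 ∧ x ≠ 1)
    (hind : NIndependent (I : Set ℕ)) {r : ℕ} {n : ℕ → ℕ} (hn : IsModularEnum I r n) {δ : ℕ → ℤ}
    (h : ∀ i, 1 ≤ i → i < r → (n (i + 1) : ℤ) = δ i * n i - n (i - 1)) {i : ℕ} (hi : i ≤ r) :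
    convNum δ i < n i := by
  have hI' : ∀ {i}, i ≤ r → 2 ≤ n i := fun {i} hi => by
    have := hI _ (hn.apply_mem hi)
    omega
  induction i with
  | zero => have := hI' hi; simp only [convNum]; omega
  | succ j ih =>
    rcases Nat.eq_zero_or_pos j with rfl | hj
    · have := hI' hi; simp only [zero_add, convNum] at this ⊢; omega
    by_contra! hle
    have hlt := ih (by omega)
    -- The determinant identity gives n_0 = V_{j+1} n_j - V_j n_{j+1}. If n_{j+1} ≤ V_{j+1}, the
    -- rearranged coefficients are nonnegative and n_0 lies in the monoid of the others.
    have hdet : (n 0 : ℤ) = (convNum δ (j + 1) - n (j + 1)) * n j +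
        (n j - convNum δ j) * n (j + 1) := by
      have h1 := coneVal_eq_of_rec rfl h (i := j) (by omega)
      have h2 := coneVal_eq_of_rec rfl h hi
      rw [← h1, ← h2]
      simp only [coneVal]
      linear_combination (-(n 0 : ℤ)) * convNum_mul_convDen_sub δ j
    obtain ⟨p, hp⟩ := Int.eq_ofNat_of_zero_le (sub_nonneg.2 hle)
    obtain ⟨q, hq⟩ := Int.eq_ofNat_of_zero_le (sub_nonneg.2 hlt.le)
    rw [hp, hq] at hdet
    have hdet' : n 0 = p * n j + q * n (j + 1) := by exact_mod_cast hdet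
    have hmem : ∀ {i}, 1 ≤ i → i ≤ r → n i ∈ AddSubmonoid.closure ((I : Set ℕ) \ {n 0}) := by
      intro i h1 hi
      refine AddSubmonoid.subset_closure ⟨hn.apply_mem hi, fun heq => ?_⟩
      have := hn.bijOn.injOn ⟨Nat.zero_le _, hi⟩ ⟨le_rfl, Nat.zero_le _⟩ heq
      omega
    refine hind _ (hn.apply_mem (Nat.zero_le r)) ?_
    convert add_mem (nsmul_mem (hmem hj (by omega)) p) (nsmul_mem (hmem (by omega) hi) q) using 1
    simpa only [smul_eq_mul] using hdet'

theorem infinite_setOf_admissible {I : Finset ℕ} (hI : ∀ x ∈ I, x ≠ 0 ∧ x ≠ 1)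
    (hind : NIndependent (I : Set ℕ)) {r : ℕ} {n : ℕ → ℕ} (hn : IsModularEnum I r n) :
    Set.Infinite {t : ℕ × ℕ × ℕ | ∃ δ : ℕ → ℤ, IsExtension r n (r + 1) δ ∧
        IsTriple n (r + 1) δ t.1 t.2.1 t.2.2 ∧ Admissible r δ t.1 t.2.1 t.2.2} := by
  obtain ⟨c, hc⟩ := hn.modularConvex
  obtain ⟨s, hs⟩ : ∃ s, r = s + 1 := ⟨r - 1, by have := hn.one_le; omega⟩
  have hmem := hI _ (hn.apply_mem le_rfl)
  have hrec : ∀ t : ℤ, ∀ i, 1 ≤ i → i < r →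
      (n (i + 1) : ℤ) = (if i = r then t else (c i + 2 : ℤ)) * n i - n (i - 1) := by
    intro t i hi hir
    have := hc i hi hir
    simp only [nsmul_eq_mul, Nat.cast_ofNat] at this
    rw [if_neg hir.ne]
    linarith
  have hcop : ∀ i, i < r → IsCoprime (n i : ℤ) (n (i + 1)) := by
    intro i
    induction i with
    | zero => exact fun _ => Nat.isCoprime_iff_coprime.2 hn.coprime
    | succ k ih =>
      intro hk
      rw [hrec 0 (k + 1) (by omega) hk, Nat.add_sub_cancel, sub_eq_add_neg,
        add_comm (_ * _), IsCoprime.add_mul_right_right_iff]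
      exact (ih (by omega)).symm.neg_right
  refine Set.Infinite.of_image (fun t => t.2.1) (Set.infinite_of_forall_exists_gt fun N => ?_)
  -- Dirichlet: b = t n_r - n_{r-1} is prime. The bound makes b exceed N and n_0 (so b is coprime to
  -- a), and t large enough for a ≤ q_r and d < b.
  obtain ⟨b, hbN, hbp, hb⟩ := Nat.forall_exists_prime_gt_and_zmodEq
    (n r * (n s + n 0 + 2) + n 0 + N) (q := n r) (a := -n s) hmem.1
    (by have := hcop s (by omega); rw [← hs] at this; exact this.neg_left)
  obtain ⟨t, ht⟩ := hb.symm.dvd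
  have hbN' : (n r * (n s + n 0 + 2) + n 0 + N : ℤ) < b := by exact_mod_cast hbN
  have hnr : (0 : ℤ) < n r := by exact_mod_cast Nat.pos_of_ne_zero hmem.1
  have htlt : (n s + n 0 + 2 : ℤ) < t := by
    refine lt_of_mul_lt_mul_left ?_ hnr.le
    rw [← ht]
    linarith [Int.natCast_nonneg (n s), Int.natCast_nonneg (n 0), Int.natCast_nonneg N]
  obtain ⟨δ, hδ⟩ : ∃ δ : ℕ → ℤ, δ = fun i => if i = r then t else (c i + 2 : ℤ) := ⟨_, rfl⟩
  have hδr : δ r = t := by rw [hδ]; simp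
  have hrec' : ∀ i, 1 ≤ i → i < r → (n (i + 1) : ℤ) = δ i * n i - n (i - 1) := by
    rw [hδ]; exact hrec t
  have h2 : ∀ i, 1 ≤ i → i < r + 1 → 2 ≤ δ i := by
    intro i _ _
    rw [hδ]
    dsimp only
    split_ifs <;> omega
  have h2' : ∀ i, 1 ≤ i → i ≤ r → 2 ≤ δ i := fun i hi hir => h2 i hi (by omega)
  have hVs := convNum_nonneg_lt (δ := δ) (i := s) fun i hi his => h2 i hi (by omega)
  have hVr := hn.convNum_lt hI hind hrec' le_rfl
  have hV : convNum δ (r + 1) = t * convNum δ r - convNum δ s := by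
    rw [← hδr, hs, convNum_rec]
  have hbt : (b : ℤ) = t * n r - n s := by linarith
  rw [← hs] at hVs
  obtain ⟨d, hd⟩ := Int.eq_ofNat_of_zero_le (convNum_nonneg (ρ := r + 1) h2 le_rfl)
  have hWpos := convDen_pos hn.one_le h2'
  obtain ⟨m, hm⟩ := Int.eq_ofNat_of_zero_le hWpos.le
  have had : (n 0 : ℤ) ≤ convNum δ (r + 1) := by
    rw [hV]
    nlinarith
  have hn0 := hI _ (hn.apply_mem (Nat.zero_le r))
  have hval : (b : ℤ) = d * n 1 - m * n 0 := by
    have e1 := coneVal_eq_of_rec rfl hrec' (le_refl r)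
    have e2 := coneVal_eq_of_rec rfl hrec' (i := s) (by omega)
    have e3 := coneVal_rec δ (n 0) (n 1) s
    rw [← hs, e1, e2, hδr, ← hbt, show s + 2 = r + 1 by omega] at e3
    rw [← e3, coneVal, hd, hm]
  refine ⟨b, ⟨(n 0, b, d), ⟨δ, ⟨by omega, h2, hrec'⟩, ⟨m, ?_, ?_, ?_, ?_, rfl, hval⟩, ?_, ?_, ?_⟩,
    rfl⟩, by omega⟩
  · dsimp only; omega
  · omega
  · rw [← Nat.isCoprime_iff_coprime, ← hd, ← hm]
    exact isCoprime_convNum_convDen δ (r + 1)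
  · rw [Nat.add_sub_cancel, ceilConv_eq_div hn.one_le h2', hd, hm]
    simp
  · refine ((Nat.Prime.coprime_iff_not_dvd hbp).2 fun hdvd => ?_).symm
    have := Nat.le_of_dvd (Nat.pos_of_ne_zero hn0.1) hdvd
    omega
  · rw [num_ceilConv hn.one_le h2']
    exact had
  · dsimp only
    have : (d : ℤ) < b := by
      rw [← hd, hV, hbt]
      -- b - d = t (n_r - V_r) - (n_s - V_s), where n_r - V_r ≥ 1 and t > n_s.
      nlinarith
    exact_mod_cast this

end ReverseProblem

theorem theorem2 (I : Finset ℕ) (hI : ∀ x ∈ I, x ≠ 0 ∧ x ≠ 1)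
    (hind : ReverseProblem.NIndependent (I : Set ℕ))
    (r : ℕ) (n : ℕ → ℕ) (hn : ReverseProblem.IsModularEnum I r n) :
    -- (i)
    (∀ (ρ : ℕ) (δ : ℕ → ℤ) (a b d : ℕ),
      ReverseProblem.IsExtension r n ρ δ → ReverseProblem.IsTriple n ρ δ a b d →
      ReverseProblem.Admissible r δ a b d → ReverseProblem.IsSolution I a b d) ∧
    -- (ii)
    (∀ a b d : ℕ, ReverseProblem.IsSolution I a b d →
      ∃ (r' : ℕ) (n' : ℕ → ℕ) (ρ : ℕ) (δ : ℕ → ℤ),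
        ReverseProblem.IsModularEnum I r' n' ∧ ReverseProblem.IsExtension r' n' ρ δ ∧
        ReverseProblem.IsTriple n' ρ δ a b d ∧ ReverseProblem.Admissible r' δ a b d) ∧
    -- (iii)
    Set.Infinite {t : ℕ × ℕ × ℕ | ReverseProblem.IsSolution I t.1 t.2.1 t.2.2 ∧
      ∃ δ : ℕ → ℤ, ReverseProblem.IsExtension r n (r + 1) δ ∧
        ReverseProblem.IsTriple n (r + 1) δ t.1 t.2.1 t.2.2 ∧
        ReverseProblem.Admissible r δ t.1 t.2.1 t.2.2} := by
  refine ⟨fun ρ δ a b d => ReverseProblem.isSolution_of_admissible hI hind hn,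
    fun a b d => ReverseProblem.exists_admissible_of_isSolution hI, ?_⟩
  refine (ReverseProblem.infinite_setOf_admissible hI hind hn).mono ?_
  rintro t ⟨δ, hext, ht, hadm⟩
  exact ⟨ReverseProblem.isSolution_of_admissible hI hind hn hext ht hadm, δ, hext, ht, hadm⟩
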